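/- Let $N\ge 1$ and let $\varepsilon_1,\varepsilon_2,\rho_1,\rho_2,\alpha_1,\alpha_2$ be real numbers. Consider the coupled Hirota system for $u_1(x,t),u_2(x,t)$ with $(x,t)\in\mathbb R^2$: $$u_{j,t}=u_{j,xxx}-3\left(\varepsilon_1|u_1|^2+\varepsilon_2|u_2|^2\right)u_{j,x}-3u_j\left(\varepsilon_1u_1^*u_{1,x}+\varepsilon_2u_2^*u_{2,x}\right),\qquad j=1,2,$$ where $*$ denotes complex conjugation. Let $p_i,q_i\in\mathbb C$ and $d_i,\xi_{i,0}\in\mathbb R$ $(1\le i\le N)$ be such that $p_i+q_j\ne0$, $p_i\ne \mathrm i\alpha_1,\mathrm i\alpha_2$ and $q_i\neq-\mathrm i\alpha_1,-\mathrm i\alpha_2$ for all $i,j$. Suppose that for some integer $h$ with $0\le h\le\lfloor N/2\rfloor$ $$p_i=q_i^*,\quad p_{N+1-i}=q_{N+1-i}^*\qquad\text{for } 1\le i\le h,$$ $$p_i=q_{N+1-i}^*,\quad p_{N+1-i}=q_i^*,\quad d_i=d_{N+1-i},\quad \xi_{i,0}=\xi_{N+1-i,0}\qquad\text{for } h+1\le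 i\le\lceil N/2\rceil,$$ and that $G(p_i,q_i)=0$ for $i=1,\dots,N$, where $$G(p,q)=\frac{\varepsilon_1\rho_1^2}{(p-\mathrm i\alpha_1)(q+\mathrm i\alpha_1)}+\frac{\varepsilon_2\rho_2^2}{(p-\mathrm i\alpha_2)(q+\mathrm i\alpha_2)}-1.$$ Put $c=\varepsilon_1\rho_1^2+\varepsilon_2\rho_2^2$, $$\xi_i=p_i(x-3ct)+p_i^3t+\xi_{i,0},\qquad \eta_i=q_i(x-3ct)+q_i^3t+\xi_{i,0},$$ $$\tau_{k,l}=\det\left(\delta_{ij}d_ie^{-\xi_i-\eta_j}+\frac1{p_i+q_j}\left(-\frac{p_i-\mathrm i\alpha_1}{q_j+\mathrm i\alpha_1}\right)^k\left(-\frac{p_i-\mathrm i\alpha_2}{q_j+\mathrm i\alpha_2}\right)^l\right)_{1\le i,j\le N}\qquad(k,l\in\mathbb Z),$$ and $f=\tau_{0,0}$, $g_1=\tau_{1,0}$, $g_2=\tau_{0,1}$. Then the functions $$u_j=\rho_j\,\frac{g_j}{f}\,\exp\left(\mathrm i(\alpha_jx-\omega_jt)\right),\qquad \omega_j=\alpha_j^3+3\alpha_jc+3\left(\varepsilon_1\rho_1^2\alpha_1+\varepsilon_2\rho_2^2\alpha_2\right),\qquad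 j=1,2,$$ are smooth and solve the coupled Hirota system on the open set of those $(x,t)\in\mathbb R^2$ at which $f(x,t)\ne0$. -/

import Mathlib

open scoped ComplexConjugate ContDiff

namespace CoupledHirota

noncomputable section

/-- The right-hand side
`u_xxx - 3 (ε₁ |u₁|² + ε₂ |u₂|²) u_x - 3 u (ε₁ u₁^* u_{1,x} + ε₂ u₂^* u_{2,x})`
of the equation for the component `u` of the coupled Hirota system, at the point `(x, t)`. -/
def rhs (ε₁ ε₂ : ℝ) (u₁ u₂ u : ℝ → ℝ → ℂ) (x t : ℝ) : ℂ :=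
  iteratedDeriv 3 (fun y => u y t) x
    - 3 * (ε₁ * (‖u₁ x t‖ : ℂ) ^ 2 + ε₂ * (‖u₂ x t‖ : ℂ) ^ 2) * deriv (fun y => u y t) x
    - 3 * u x t * (ε₁ * conj (u₁ x t) * deriv (fun y => u₁ y t) x
        + ε₂ * conj (u₂ x t) * deriv (fun y => u₂ y t) x)

/-- `(u₁, u₂)` is a smooth solution of the coupled Hirota system on the open set `Ω` of the
`(x, t)`-plane. -/
structure IsSolutionOn (ε₁ ε₂ : ℝ) (u₁ u₂ : ℝ → ℝ → ℂ) (Ω : Set (ℝ × ℝ)) : Prop where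
  isOpen : IsOpen Ω
  smooth₁ : ContDiffOn ℝ ∞ (fun z : ℝ × ℝ => u₁ z.1 z.2) Ω
  smooth₂ : ContDiffOn ℝ ∞ (fun z : ℝ × ℝ => u₂ z.1 z.2) Ω
  eq₁ : ∀ x t : ℝ, (x, t) ∈ Ω → deriv (fun s => u₁ x s) t = rhs ε₁ ε₂ u₁ u₂ u₁ x t
  eq₂ : ∀ x t : ℝ, (x, t) ∈ Ω → deriv (fun s => u₂ x s) t = rhs ε₁ ε₂ u₁ u₂ u₂ x t

/-- The phase `p (x - 3 (ε₁ ρ₁² + ε₂ ρ₂²) t) + p³ t + ξ₀`.  It gives `ξ_i` for `p = p_i` and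
`η_i` for `p = q_i`, with the same real shift `ξ₀ = ξ_{i,0}`. -/
def phase (ε₁ ε₂ ρ₁ ρ₂ : ℝ) (p : ℂ) (ξ₀ x t : ℝ) : ℂ :=
  p * (x - 3 * (ε₁ * ρ₁ ^ 2 + ε₂ * ρ₂ ^ 2) * t) + p ^ 3 * t + ξ₀

/-- The determinant `τ_{k,l}`. -/
def tau {N : ℕ} (ε₁ ε₂ ρ₁ ρ₂ α₁ α₂ : ℝ) (p q : Fin N → ℂ) (d ξ₀ : Fin N → ℝ) (k l : ℤ)
    (x t : ℝ) : ℂ :=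
  Matrix.det (Matrix.of fun i j : Fin N =>
    (if i = j then
      (d i : ℂ) * Complex.exp (-phase ε₁ ε₂ ρ₁ ρ₂ (p i) (ξ₀ i) x t
        - phase ε₁ ε₂ ρ₁ ρ₂ (q j) (ξ₀ j) x t)
      else 0)
    + 1 / (p i + q j)
      * (-((p i - Complex.I * α₁) / (q j + Complex.I * α₁))) ^ k
      * (-((p i - Complex.I * α₂) / (q j + Complex.I * α₂))) ^ l)

/-- The frequency `α³ + 3 α (ε₁ ρ₁² + ε₂ ρ₂²) + 3 (ε₁ ρ₁² α₁ + ε₂ ρ₂² α₂)`, which is `ω_j`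
for `α = α_j`. -/
def omega (ε₁ ε₂ ρ₁ ρ₂ α₁ α₂ α : ℝ) : ℝ :=
  α ^ 3 + 3 * α * (ε₁ * ρ₁ ^ 2 + ε₂ * ρ₂ ^ 2) + 3 * (ε₁ * ρ₁ ^ 2 * α₁ + ε₂ * ρ₂ ^ 2 * α₂)

/-- The function `G(p, q)`. -/
def G (ε₁ ε₂ ρ₁ ρ₂ α₁ α₂ : ℝ) (p q : ℂ) : ℂ :=
  ε₁ * ρ₁ ^ 2 / ((p - Complex.I * α₁) * (q + Complex.I * α₁))
    + ε₂ * ρ₂ ^ 2 / ((p - Complex.I * α₂) * (q + Complex.I * α₂)) - 1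

/-- The complex conjugacy relations with index `h`.  Here `i : Fin N` stands for the index
`i + 1` of `1, …, N`, so that `i.rev` stands for `N + 1 - (i + 1)`, and `(N + 1) / 2` is `⌈N/2⌉`.
The numbers `d i` and `ξ₀ i` are real by their type. -/
structure ConjRel {N : ℕ} (h : ℕ) (p q : Fin N → ℂ) (d ξ₀ : Fin N → ℝ) : Prop where
  self : ∀ i : Fin N, (i : ℕ) + 1 ≤ h → p i = conj (q i) ∧ p i.rev = conj (q i.rev)
  paired : ∀ i : Fin N, h + 1 ≤ (i : ℕ) + 1 → (i : ℕ) + 1 ≤ (N + 1) / 2 →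
    p i = conj (q i.rev) ∧ p i.rev = conj (q i) ∧ d i = d i.rev ∧ ξ₀ i = ξ₀ i.rev

/-- The function `ρ (g / f) exp(i (α x - w t))`. -/
def soliton (ρ α w : ℝ) (g f : ℝ → ℝ → ℂ) (x t : ℝ) : ℂ :=
  ρ * (g x t / f x t) * Complex.exp (Complex.I * (α * x - w * t))

end

end CoupledHirota

/-!
Write `P = diag(p_i)`, `Q = diag(q_i)`, let `1` be the vector of ones, and let `A = E + C` be the
matrix of `τ_{0,0}`, with `E = diag(d_i exp(-ξ_i - η_i))` and `C` the Cauchy matrix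
`(1 / (p_i + q_j))`.  The proof does not use bilinear equations between tau functions: it works with
the moments `⟨a, b⟩ = aᵀ A⁻¹ b` on the set `f = det A ≠ 0`.

The shift `k ↦ k ± 1` changes `A` by a matrix of rank one, so the matrix determinant lemma gives
`g / f = w = 1 - ⟨(Q + z)⁻¹ 1, 1⟩` with `z = i α`, and the ratio with the opposite shift is
`v = 1 - ⟨1, (P - z)⁻¹ 1⟩` (`det_shift`, `det_shift_inv`).  The conjugacy relations make `f` real
and give `v = conj w` (`conj_tau`).

Because `P C + C Q = 1 1ᵀ`, derivatives of moments are polynomials in moments (`dressed_eq`).  With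
`y = ⟨1, 1⟩`, `φ = ⟨1, p⟩` and `c = ∑ ε_k ρ_k²`, computing three `x`-derivatives and
one `t`-derivative gives the linear equation
`w_t = (∂ₓ + z)³ w - 3 (c - y_x) (∂ₓ + z) w - 3 w (y y_x - φ_x) + (3 c z - z³) w`
for every `z` with `q_i + z ≠ 0`, before `G(p_i, q_i) = 0` is used (`hasDerivAt_wave_time`).

The constraint `G(p_i, q_i) = 0`, multiplied by `p_i + q_i`, says
`∑ ε_k ρ_k² ((p_i - i α_k)⁻¹ + (q_i + i α_k)⁻¹) = p_i + q_i`.  Inserting both sides into the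
displacement identity gives `∑ ε_k ρ_k² v_k w_k = c - y_x` and
`∑ ε_k ρ_k² v_k (∂ₓ + i α_k) w_k = ∑ ε_k ρ_k² i α_k + y y_x - φ_x`
(`sum_coWave_mul_wave`, `sum_coWave_mul_wave₁`).  These are the two nonlinear terms of the system,
so the linear equation becomes the coupled Hirota system, and the remaining constants
add up to `ω_j`.
-/

open scoped ComplexConjugate ContDiff

namespace CoupledHirota

noncomputable section

open Matrix

variable {ι : Type*}

/-! ### The Gram-type matrix and its moments -/

/-- The diagonal `1 / (q_i + z)` of the resolvent `(Q + z)⁻¹`, where `Q = diag(q_i)`.  The resolvent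
`(P - z)⁻¹` of `P = diag(p_i)` is `pole p (-z)`. -/
def pole (q : ι → ℂ) (z : ℂ) : ι → ℂ := fun i => 1 / (q i + z)

lemma pole_mul {q : ι → ℂ} {z : ℂ} (h : ∀ i, q i + z ≠ 0) : pole q z * q = 1 - z • pole q z := by
  funext i
  have := h i
  simp [pole]
  field_simp
  ring

variable [Fintype ι]

open scoped Matrix.Norms.Operator in
lemma hasDerivAt_dotProduct_mulVec {A : ℝ → Matrix ι ι ℂ} {A' : Matrix ι ι ℂ} {x : ℝ}
    (hA : HasDerivAt A A' x) (a b : ι → ℂ) :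
    HasDerivAt (fun y => a ⬝ᵥ (A y *ᵥ b)) (a ⬝ᵥ (A' *ᵥ b)) x := by
  let T : Matrix ι ι ℂ →ₗ[ℝ] ℂ :=
    { toFun := fun M => a ⬝ᵥ (M *ᵥ b)
      map_add' := fun M M' => by simp [add_mulVec]
      map_smul' := fun c M => by simp [smul_mulVec, dotProduct_smul] }
  exact (T.toContinuousLinearMap.hasFDerivAt).comp_hasDerivAt x hA

variable [DecidableEq ι]

/-- The Gram-type matrix `A = diag(e_i) + (1 / (p_i + q_j))`, whose determinant is the tau function
`τ_{0,0}` when `e` is the exponential `excitation`. -/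
def gram (p q e : ι → ℂ) : Matrix ι ι ℂ :=
  diagonal e + Matrix.of fun i j => 1 / (p i + q j)

/-- The bilinear form `⟨a, b⟩ = aᵀ A⁻¹ b` of the inverse of the Gram-type matrix `A`.  It has its
meaning only where `det A ≠ 0`. -/
def moment (p q e a b : ι → ℂ) : ℂ := a ⬝ᵥ ((gram p q e)⁻¹ *ᵥ b)

lemma moment_add_left (p q e a a' b : ι → ℂ) :
    moment p q e (a + a') b = moment p q e a b + moment p q e a' b := by
  simp [moment, add_dotProduct]

lemma moment_sub_left (p q e a a' b : ι → ℂ) :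
    moment p q e (a - a') b = moment p q e a b - moment p q e a' b := by
  simp [moment, sub_dotProduct]

lemma moment_smul_left (p q e a b : ι → ℂ) (c : ℂ) :
    moment p q e (c • a) b = c * moment p q e a b := by
  simp [moment]

lemma moment_add_right (p q e a b b' : ι → ℂ) :
    moment p q e a (b + b') = moment p q e a b + moment p q e a b' := by
  simp [moment, mulVec_add]

lemma moment_sub_right (p q e a b b' : ι → ℂ) :
    moment p q e a (b - b') = moment p q e a b - moment p q e a b' := by
  simp [moment, mulVec_sub]

lemma moment_smul_right (p q e a b : ι → ℂ) (c : ℂ) :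
    moment p q e a (c • b) = c * moment p q e a b := by
  simp [moment, mulVec_smul]

/-- The bilinear form `aᵀ A⁻¹ diag(m) A⁻¹ b`, which is minus the derivative of `⟨a, b⟩` when `e` has
derivative `m`. -/
def dressed (p q e m a b : ι → ℂ) : ℂ :=
  moment p q e a (m * ((gram p q e)⁻¹ *ᵥ b))

lemma dressed_add (p q e m m' a b : ι → ℂ) :
    dressed p q e (m + m') a b = dressed p q e m a b + dressed p q e m' a b := by
  simp [dressed, add_mul, moment_add_right]

lemma dressed_smul (p q e m a b : ι → ℂ) (c : ℂ) :
    dressed p q e (c • m) a b = c * dressed p q e m a b := by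
  simp [dressed, moment_smul_right]

/-- If the displacement `R C + C S` of the Cauchy matrix `C = (1 / (p_i + q_j))` by diagonal
matrices `R`, `S` has low rank `∑ x_k y_kᵀ`, then `diag((r + s) e) = R A + A S - ∑ x_k y_kᵀ`, and
multiplying by `A⁻¹` on both sides turns `aᵀ A⁻¹ diag((r + s) e) A⁻¹ b` into moments. -/
lemma dressed_eq {n : ℕ} {p q e r s : ι → ℂ} (x y : Fin n → ι → ℂ)
    (hpq : ∀ i j, p i + q j ≠ 0) (hdet : (gram p q e).det ≠ 0)
    (h : ∀ i j, r i + s j = (p i + q j) * ∑ k, x k i * y k j) (a b : ι → ℂ) :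
    dressed p q e ((r + s) * e) a b = moment p q e a (r * b) + moment p q e (a * s) b
      - ∑ k, moment p q e a (x k) * moment p q e (y k) b := by
  have hu : IsUnit (gram p q e).det := isUnit_iff_ne_zero.mpr hdet
  set v := (gram p q e)⁻¹ *ᵥ b with hv
  have hb : b = gram p q e *ᵥ v := by
    rw [hv, mulVec_mulVec, mul_nonsing_inv _ hu, one_mulVec]
  -- Here `diag((r + s) e) v` is computed from `A v = b`.
  have key : (r + s) * e * v = r * b + gram p q e *ᵥ (s * v) - ∑ k, (y k ⬝ᵥ v) • x k := by
    rw [hb]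
    funext i
    have h2 : ∑ k, (y k ⬝ᵥ v) * x k i = ∑ j, (1 / (p i + q j)) * (r i + s j) * v j := by
      simp only [dotProduct, Finset.sum_mul]
      rw [Finset.sum_comm]
      refine Finset.sum_congr rfl fun j _ => ?_
      rw [h i j, ← mul_assoc, one_div_mul_cancel (hpq i j), one_mul, Finset.sum_mul]
      exact Finset.sum_congr rfl fun k _ => by ring
    simp only [gram, add_mulVec, Pi.sub_apply, Pi.add_apply, Pi.mul_apply, mulVec_diagonal,
      Finset.sum_apply, Pi.smul_apply, smul_eq_mul, h2]
    simp only [mulVec, dotProduct, Matrix.of_apply, Pi.mul_apply, mul_add, Finset.mul_sum,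
      add_mul, Finset.sum_add_distrib]
    have h3 : ∑ j, 1 / (p i + q j) * r i * v j = ∑ j, r i * (1 / (p i + q j) * v j) :=
      Finset.sum_congr rfl fun k _ => by ring
    have h4 : ∑ j, 1 / (p i + q j) * s j * v j = ∑ j, 1 / (p i + q j) * (s j * v j) :=
      Finset.sum_congr rfl fun k _ => by ring
    rw [h3, h4]
    ring
  rw [dressed, ← hv, key]
  rw [moment_sub_right, moment_add_right]
  congr 1
  · congr 1
    rw [moment, mulVec_mulVec, nonsing_inv_mul _ hu, one_mulVec, moment, ← hv]
    simp [dotProduct, mul_assoc]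
  · simp only [moment, mulVec_sum, dotProduct_sum, mulVec_smul, dotProduct_smul, smul_eq_mul]
    exact Finset.sum_congr rfl fun k _ => by rw [mul_comm]

open scoped Matrix.Norms.Operator in
lemma hasDerivAt_matrix_inv {A : ℝ → Matrix ι ι ℂ} {A' : Matrix ι ι ℂ} {x : ℝ}
    (hA : HasDerivAt A A' x) (hdet : (A x).det ≠ 0) :
    HasDerivAt (fun y => (A y)⁻¹) (-((A x)⁻¹ * A' * (A x)⁻¹)) x := by
  obtain ⟨u, hu⟩ := (isUnit_iff_isUnit_det _).mpr (isUnit_iff_ne_zero.mpr hdet)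
  have h := hasFDerivAt_ringInverse (𝕜 := ℝ) u
  rw [hu] at h
  have h1 := h.comp_hasDerivAt x hA
  have hui : (↑u⁻¹ : Matrix ι ι ℂ) = (A x)⁻¹ := by
    rw [← hu, coe_units_inv]
  simp only [nonsing_inv_eq_ringInverse] at hui ⊢
  rw [hui] at h1
  exact h1

open scoped Matrix.Norms.Operator in
lemma hasDerivAt_gram {p q e' : ι → ℂ} {e : ℝ → ι → ℂ} {x : ℝ} (he : HasDerivAt e e' x) :
    HasDerivAt (fun y => gram p q (e y)) (diagonal e') x :=
  (((diagonalLinearMap ι ℝ ℂ).toContinuousLinearMap.hasFDerivAt).comp_hasDerivAt x he).add_const _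

open scoped Matrix.Norms.Operator in
lemma hasDerivAt_moment {p q e' : ι → ℂ} {e : ℝ → ι → ℂ} {x : ℝ}
    (he : HasDerivAt e e' x) (hdet : (gram p q (e x)).det ≠ 0) (a b : ι → ℂ) :
    HasDerivAt (fun y => moment p q (e y) a b) (-dressed p q (e x) e' a b) x := by
  refine (hasDerivAt_dotProduct_mulVec
    (hasDerivAt_matrix_inv (hasDerivAt_gram he) hdet) a b).congr_deriv ?_
  have hm : e' * ((gram p q (e x))⁻¹ *ᵥ b) = diagonal e' *ᵥ ((gram p q (e x))⁻¹ *ᵥ b) := by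
    funext i
    simp [mulVec_diagonal]
  rw [dressed, moment, hm, neg_mulVec, dotProduct_neg, mulVec_mulVec, mulVec_mulVec,
    mul_assoc]

/-- The matrix determinant lemma for a rank-one perturbation of the Gram-type matrix. -/
lemma det_gram_sub_vecMulVec (p q e x y : ι → ℂ) (hdet : (gram p q e).det ≠ 0) :
    (gram p q e - vecMulVec x y).det = (gram p q e).det * (1 - moment p q e y x) := by
  have := det_add_replicateCol_mul_replicateRow (ι := Unit) (isUnit_iff_ne_zero.mpr hdet) (-x) y
  rw [sub_eq_add_neg]
  convert this using 2
  · congr 1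
    ext i j
    simp [vecMulVec, Matrix.mul_apply]
  · simp [moment, Matrix.mul_apply, dotProduct, mulVec, Finset.sum_mul, Finset.mul_sum]
    rw [sub_eq_add_neg, ← Finset.sum_neg_distrib, Finset.sum_comm]
    simp [mul_assoc]

/-! ### Displacement identities for the flows -/

lemma dressed_add_mul {p q e : ι → ℂ} (hpq : ∀ i j, p i + q j ≠ 0)
    (hdet : (gram p q e).det ≠ 0) (a b : ι → ℂ) :
    dressed p q e ((p + q) * e) a b = moment p q e a (p * b) + moment p q e (a * q) b
      - moment p q e a 1 * moment p q e 1 b := by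
  simpa using dressed_eq (r := p) (s := q) ![1] ![1] hpq hdet (by simp) a b

/-- Here the displacement is `P³ C + C Q³ = P² 1 1ᵀ - P 1 1ᵀ Q + 1 1ᵀ Q²`. -/
lemma dressed_cube_mul {p q e : ι → ℂ} (hpq : ∀ i j, p i + q j ≠ 0)
    (hdet : (gram p q e).det ≠ 0) (a b : ι → ℂ) :
    dressed p q e ((p ^ 3 + q ^ 3) * e) a b
      = moment p q e a (p ^ 3 * b) + moment p q e (a * q ^ 3) b
      - (moment p q e a (p ^ 2) * moment p q e 1 b - moment p q e a p * moment p q e q b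
        + moment p q e a 1 * moment p q e (q ^ 2) b) := by
  rw [dressed_eq (r := p ^ 3) (s := q ^ 3) ![p ^ 2, -p, 1] ![1, q, q ^ 2] hpq hdet
    (fun i j => by simp [Fin.sum_univ_three]; ring) a b]
  have : moment p q e a (-p) = - moment p q e a p := by
    simpa using moment_smul_right p q e a p (-1)
  simp [Fin.sum_univ_three, this]
  ring

/-- Here the displacement is `(P - z)⁻¹ C + C (Q + z)⁻¹ = (P - z)⁻¹ 1 1ᵀ (Q + z)⁻¹`. -/
lemma dressed_pole_mul {p q e : ι → ℂ} {z : ℂ} (hpq : ∀ i j, p i + q j ≠ 0)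
    (hp : ∀ i, p i - z ≠ 0) (hq : ∀ i, q i + z ≠ 0)
    (hdet : (gram p q e).det ≠ 0) (a b : ι → ℂ) :
    dressed p q e ((pole p (-z) + pole q z) * e) a b
      = moment p q e a (pole p (-z) * b) + moment p q e (a * pole q z) b
      - moment p q e a (pole p (-z)) * moment p q e (pole q z) b := by
  simpa using dressed_eq (r := pole p (-z)) (s := pole q z) ![pole p (-z)] ![pole q z] hpq hdet
    (fun i j => by
      have h1 := hp i
      have h2 := hq j
      simp only [Finset.univ_unique, Finset.sum_singleton, cons_val_fin_one, pole,
        ← sub_eq_add_neg]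
      field_simp
      ring) a b

/-! ### Wave functions and the constraint -/

/-- The function `1 - 1ᵀ (Q + z)⁻¹ A⁻¹ 1`, which is the ratio `τ_{1,0} / τ_{0,0}` for `z = i α₁` and
`τ_{0,1} / τ_{0,0}` for `z = i α₂`. -/
def wave (p q e : ι → ℂ) (z : ℂ) : ℂ := 1 - moment p q e (pole q z) 1

/-- The function `1 - 1ᵀ A⁻¹ (P - z)⁻¹ 1`, which is the ratio `τ_{-1,0} / τ_{0,0}` for `z = i α₁`
and `τ_{0,-1} / τ_{0,0}` for `z = i α₂`. -/
def coWave (p q e : ι → ℂ) (z : ℂ) : ℂ := 1 - moment p q e 1 (pole p (-z))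

/-- The closed form of `(∂ₓ + z) wave` when `∂ₓ e = -(p + q) e`: with `z = i α` this is the
`x`-derivative once the carrier `exp(i α x)` is included. -/
def wave₁ (p q e : ι → ℂ) (z : ℂ) : ℂ :=
  z - moment p q e (pole q z) p - wave p q e z * moment p q e 1 1

/-- The `x`-derivative of the moment `⟨1, 1⟩` (the mass) when `∂ₓ e = -(p + q) e`.  It equals
`∂ₓ² log τ_{0,0}`, since `∂ₓ log τ_{0,0}` differs from `⟨1, 1⟩` by a constant. -/
def massDeriv (p q e : ι → ℂ) : ℂ :=
  moment p q e 1 p + moment p q e q 1 - moment p q e 1 1 ^ 2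

/-- The `x`-derivative of the moment `⟨1, p⟩` (the flux) when `∂ₓ e = -(p + q) e`. -/
def fluxDeriv (p q e : ι → ℂ) : ℂ :=
  moment p q e 1 (p ^ 2) + moment p q e q p - moment p q e 1 1 * moment p q e 1 p

/-- The constraint `G = 0` expresses the `x`-flow through the flows with poles at `z₁` and `z₂`.
Paired with the vectors `1`, `1`, this computes the density `∑ κ_k v_k w_k`, where `v_k`, `w_k` are
the values of `coWave`, `wave` at `z_k`. -/
lemma sum_coWave_mul_wave {p q e : ι → ℂ} {z₁ z₂ κ₁ κ₂ : ℂ} (hpq : ∀ i j, p i + q j ≠ 0)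
    (hp₁ : ∀ i, p i - z₁ ≠ 0) (hp₂ : ∀ i, p i - z₂ ≠ 0)
    (hq₁ : ∀ i, q i + z₁ ≠ 0) (hq₂ : ∀ i, q i + z₂ ≠ 0)
    (hdet : (gram p q e).det ≠ 0)
    (hG : κ₁ • (pole p (-z₁) + pole q z₁) + κ₂ • (pole p (-z₂) + pole q z₂) = p + q) :
    κ₁ * (1 - coWave p q e z₁ * wave p q e z₁) + κ₂ * (1 - coWave p q e z₂ * wave p q e z₂)
      = massDeriv p q e := by
  have h := dressed_add_mul hpq hdet 1 1
  rw [← hG, add_mul, smul_mul_assoc, smul_mul_assoc, dressed_add, dressed_smul, dressed_smul,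
    dressed_pole_mul hpq hp₁ hq₁ hdet, dressed_pole_mul hpq hp₂ hq₂ hdet] at h
  simp only [mul_one, one_mul] at h
  simp only [wave, coWave, massDeriv]
  linear_combination h

/-- The same comparison of flows, paired with the vectors `1`, `p`, computes
`∑ κ_k v_k (∂ₓ + z_k) w_k`, which is the term `∑ ε_k u_k^* u_{k,x}` of the system. -/
lemma sum_coWave_mul_wave₁ {p q e : ι → ℂ} {z₁ z₂ κ₁ κ₂ : ℂ} (hpq : ∀ i j, p i + q j ≠ 0)
    (hp₁ : ∀ i, p i - z₁ ≠ 0) (hp₂ : ∀ i, p i - z₂ ≠ 0)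
    (hq₁ : ∀ i, q i + z₁ ≠ 0) (hq₂ : ∀ i, q i + z₂ ≠ 0)
    (hdet : (gram p q e).det ≠ 0)
    (hG : κ₁ • (pole p (-z₁) + pole q z₁) + κ₂ • (pole p (-z₂) + pole q z₂) = p + q) :
    κ₁ * (coWave p q e z₁ * wave₁ p q e z₁) + κ₂ * (coWave p q e z₂ * wave₁ p q e z₂)
      = κ₁ * z₁ + κ₂ * z₂ + moment p q e 1 1 * massDeriv p q e - fluxDeriv p q e := by
  have hs := sum_coWave_mul_wave hpq hp₁ hp₂ hq₁ hq₂ hdet hG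
  have h := dressed_add_mul hpq hdet 1 p
  have e₁ := pole_mul (q := p) (z := -z₁) (by simpa [sub_eq_add_neg] using hp₁)
  have e₂ := pole_mul (q := p) (z := -z₂) (by simpa [sub_eq_add_neg] using hp₂)
  rw [← hG, add_mul, smul_mul_assoc, smul_mul_assoc, dressed_add, dressed_smul, dressed_smul,
    dressed_pole_mul hpq hp₁ hq₁ hdet, dressed_pole_mul hpq hp₂ hq₂ hdet, e₁, e₂] at h
  simp only [one_mul, moment_sub_right, moment_smul_right, ← sq] at h
  simp only [wave₁, fluxDeriv]
  simp only [wave, coWave, massDeriv] at hs ⊢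
  linear_combination moment p q e 1 1 * hs - h

/-! ### Evolution of the wave function -/

lemma hasDerivAt_moment_space {p q : ι → ℂ} {e : ℝ → ι → ℂ} {x : ℝ}
    (hpq : ∀ i j, p i + q j ≠ 0) (he : HasDerivAt e (-((p + q) * e x)) x)
    (hdet : (gram p q (e x)).det ≠ 0) (a b : ι → ℂ) :
    HasDerivAt (fun y => moment p q (e y) a b)
      (moment p q (e x) a (p * b) + moment p q (e x) (a * q) b
        - moment p q (e x) a 1 * moment p q (e x) 1 b) x := by
  refine (hasDerivAt_moment he hdet a b).congr_deriv ?_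
  rw [← dressed_add_mul hpq hdet, ← neg_one_smul ℂ ((p + q) * e x), dressed_smul]
  ring

lemma hasDerivAt_moment_pole {p q : ι → ℂ} {e : ℝ → ι → ℂ} {x : ℝ} {z : ℂ}
    (hpq : ∀ i j, p i + q j ≠ 0) (hq : ∀ i, q i + z ≠ 0)
    (he : HasDerivAt e (-((p + q) * e x)) x)
    (hdet : (gram p q (e x)).det ≠ 0) (b : ι → ℂ) :
    HasDerivAt (fun y => moment p q (e y) (pole q z) b)
      (moment p q (e x) (pole q z) (p * b) - z * moment p q (e x) (pole q z) b
        + wave p q (e x) z * moment p q (e x) 1 b) x := by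
  refine (hasDerivAt_moment_space hpq he hdet _ b).congr_deriv ?_
  rw [pole_mul hq, moment_sub_left, moment_smul_left, wave]
  ring

lemma hasDerivAt_wave {p q : ι → ℂ} {e : ℝ → ι → ℂ} {x : ℝ} {z : ℂ}
    (hpq : ∀ i j, p i + q j ≠ 0) (hq : ∀ i, q i + z ≠ 0)
    (he : HasDerivAt e (-((p + q) * e x)) x) (hdet : (gram p q (e x)).det ≠ 0) :
    HasDerivAt (fun y => wave p q (e y) z) (wave₁ p q (e x) z - z * wave p q (e x) z) x := by
  refine ((hasDerivAt_moment_pole hpq hq he hdet 1).const_sub 1).congr_deriv ?_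
  simp only [wave₁, wave, mul_one]
  ring

/-- The closed form of `(∂ₓ + z)² wave`. -/
def wave₂ (p q e : ι → ℂ) (z : ℂ) : ℂ :=
  z ^ 2 - moment p q e (pole q z) (p ^ 2) - wave p q e z * moment p q e 1 p
    - wave₁ p q e z * moment p q e 1 1 - wave p q e z * massDeriv p q e

/-- The second `x`-derivative of the moment `⟨1, 1⟩`. -/
def massDeriv₂ (p q e : ι → ℂ) : ℂ :=
  fluxDeriv p q e + moment p q e q p + moment p q e (q ^ 2) 1
    - moment p q e q 1 * moment p q e 1 1 - 2 * moment p q e 1 1 * massDeriv p q e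

/-- The closed form of `(∂ₓ + z)³ wave`. -/
def wave₃ (p q e : ι → ℂ) (z : ℂ) : ℂ :=
  z ^ 3 - moment p q e (pole q z) (p ^ 3) - wave p q e z * moment p q e 1 (p ^ 2)
    - wave₁ p q e z * moment p q e 1 p - wave p q e z * fluxDeriv p q e
    - wave₂ p q e z * moment p q e 1 1 - 2 * wave₁ p q e z * massDeriv p q e
    - wave p q e z * massDeriv₂ p q e

lemma hasDerivAt_mass {p q : ι → ℂ} {e : ℝ → ι → ℂ} {x : ℝ}
    (hpq : ∀ i j, p i + q j ≠ 0) (he : HasDerivAt e (-((p + q) * e x)) x)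
    (hdet : (gram p q (e x)).det ≠ 0) :
    HasDerivAt (fun y => moment p q (e y) 1 1) (massDeriv p q (e x)) x := by
  refine (hasDerivAt_moment_space hpq he hdet 1 1).congr_deriv ?_
  simp only [massDeriv, mul_one, one_mul]
  ring

lemma hasDerivAt_flux {p q : ι → ℂ} {e : ℝ → ι → ℂ} {x : ℝ}
    (hpq : ∀ i j, p i + q j ≠ 0) (he : HasDerivAt e (-((p + q) * e x)) x)
    (hdet : (gram p q (e x)).det ≠ 0) :
    HasDerivAt (fun y => moment p q (e y) 1 p) (fluxDeriv p q (e x)) x := by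
  refine (hasDerivAt_moment_space hpq he hdet 1 p).congr_deriv ?_
  simp only [fluxDeriv, one_mul, ← sq]

lemma hasDerivAt_massDeriv {p q : ι → ℂ} {e : ℝ → ι → ℂ} {x : ℝ}
    (hpq : ∀ i j, p i + q j ≠ 0) (he : HasDerivAt e (-((p + q) * e x)) x)
    (hdet : (gram p q (e x)).det ≠ 0) :
    HasDerivAt (fun y => massDeriv p q (e y)) (massDeriv₂ p q (e x)) x := by
  refine (((hasDerivAt_flux hpq he hdet).add
    (hasDerivAt_moment_space hpq he hdet q 1)).sub
    ((hasDerivAt_mass hpq he hdet).pow 2)).congr_deriv ?_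
  simp only [massDeriv₂, mul_one, ← sq]
  push_cast
  ring

lemma hasDerivAt_wave₁ {p q : ι → ℂ} {e : ℝ → ι → ℂ} {x : ℝ} {z : ℂ}
    (hpq : ∀ i j, p i + q j ≠ 0) (hq : ∀ i, q i + z ≠ 0)
    (he : HasDerivAt e (-((p + q) * e x)) x) (hdet : (gram p q (e x)).det ≠ 0) :
    HasDerivAt (fun y => wave₁ p q (e y) z) (wave₂ p q (e x) z - z * wave₁ p q (e x) z) x := by
  refine (((hasDerivAt_moment_pole hpq hq he hdet p).const_sub z).sub
    ((hasDerivAt_wave hpq hq he hdet).mul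
      (hasDerivAt_mass hpq he hdet))).congr_deriv ?_
  simp only [wave₂, ← sq]
  simp only [wave₁]
  ring

lemma hasDerivAt_wave₂ {p q : ι → ℂ} {e : ℝ → ι → ℂ} {x : ℝ} {z : ℂ}
    (hpq : ∀ i j, p i + q j ≠ 0) (hq : ∀ i, q i + z ≠ 0)
    (he : HasDerivAt e (-((p + q) * e x)) x) (hdet : (gram p q (e x)).det ≠ 0) :
    HasDerivAt (fun y => wave₂ p q (e y) z) (wave₃ p q (e x) z - z * wave₂ p q (e x) z) x := by
  have hw := hasDerivAt_wave hpq hq he hdet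
  refine (((((hasDerivAt_moment_pole hpq hq he hdet (p ^ 2)).const_sub (z ^ 2)).sub
    (hw.mul (hasDerivAt_flux hpq he hdet))).sub
    ((hasDerivAt_wave₁ hpq hq he hdet).mul (hasDerivAt_mass hpq he hdet))).sub
    (hw.mul (hasDerivAt_massDeriv hpq he hdet))).congr_deriv ?_
  simp only [wave₃, ← pow_succ']
  simp only [wave₂]
  ring

/-- The third KP flow of the wave function, in the frame moving with speed `3 c`: the equation `G = 0`
is not needed for this linear equation, whose potentials are moments. -/
lemma hasDerivAt_wave_time {p q : ι → ℂ} {e : ℝ → ι → ℂ} {t : ℝ} {z c : ℂ}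
    (hpq : ∀ i j, p i + q j ≠ 0) (hq : ∀ i, q i + z ≠ 0)
    (he : HasDerivAt e (-((p ^ 3 + q ^ 3) * e t) + (3 * c) • ((p + q) * e t)) t)
    (hdet : (gram p q (e t)).det ≠ 0) :
    HasDerivAt (fun s => wave p q (e s) z)
      (wave₃ p q (e t) z - 3 * (c - massDeriv p q (e t)) * wave₁ p q (e t) z
        - 3 * wave p q (e t) z
          * (moment p q (e t) 1 1 * massDeriv p q (e t) - fluxDeriv p q (e t))
        + (3 * c * z - z ^ 3) * wave p q (e t) z) t := by
  refine ((hasDerivAt_moment he hdet (pole q z) 1).const_sub 1).congr_deriv ?_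
  have h1 := pole_mul hq
  have h3 : pole q z * q ^ 3 = q ^ 2 - z • q + (z ^ 2) • (1 : ι → ℂ) - (z ^ 3) • pole q z := by
    funext i
    have := hq i
    simp [pole]
    field_simp
    ring
  rw [← neg_one_smul ℂ ((p ^ 3 + q ^ 3) * e t), dressed_add, dressed_smul, dressed_smul,
    dressed_add_mul hpq hdet, dressed_cube_mul hpq hdet, h1, h3]
  simp only [mul_one, moment_add_left, moment_sub_left, moment_smul_left, wave₃, wave₂,
    massDeriv₂]
  simp only [wave₁, wave, fluxDeriv, massDeriv]
  ring

/-! ### Passage to the carrier wave -/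

lemma iteratedDeriv_three_eq {u u₁ u₂ u₃ : ℝ → ℂ} {U : Set ℝ} (hU : IsOpen U)
    (h₁ : ∀ x ∈ U, HasDerivAt u (u₁ x) x) (h₂ : ∀ x ∈ U, HasDerivAt u₁ (u₂ x) x)
    (h₃ : ∀ x ∈ U, HasDerivAt u₂ (u₃ x) x) {x : ℝ} (hx : x ∈ U) :
    iteratedDeriv 3 u x = u₃ x := by
  have key : ∀ {v v' : ℝ → ℂ}, (∀ x ∈ U, HasDerivAt v (v' x) x) → ∀ x ∈ U,
      deriv v =ᶠ[nhds x] v' := fun h x hx =>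
    Filter.eventuallyEq_of_mem (hU.mem_nhds hx) fun y hy => (h y hy).deriv
  have e₂ : ∀ x ∈ U, HasDerivAt (deriv u) (u₂ x) x := fun x hx =>
    (h₂ x hx).congr_of_eventuallyEq (key h₁ x hx)
  have e₃ : ∀ x ∈ U, HasDerivAt (deriv (deriv u)) (u₃ x) x := fun x hx =>
    (h₃ x hx).congr_of_eventuallyEq (key e₂ x hx)
  rw [iteratedDeriv_eq_iterate]
  exact (e₃ x hx).deriv

/-- The plane wave `exp(i (α x - ν t))` of the background. -/
def carrier (α ν x t : ℝ) : ℂ := Complex.exp (Complex.I * (α * x - ν * t))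

lemma hasDerivAt_mul_carrier_space {W : ℝ → ℂ} {W' : ℂ} {ρ α ν x t : ℝ}
    (h : HasDerivAt W (W' - Complex.I * α * W x) x) :
    HasDerivAt (fun y => ρ * W y * carrier α ν y t) (ρ * W' * carrier α ν x t) x := by
  have h0 : HasDerivAt (fun y : ℝ => Complex.I * (α * (y : ℂ) - ν * t))
      (Complex.I * (α * 1)) x :=
    (((hasDerivAt_id x).ofReal_comp.const_mul (α : ℂ)).sub_const _).const_mul _
  refine ((h.const_mul (ρ : ℂ)).mul h0.cexp).congr_deriv ?_
  simp only [carrier]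
  ring

lemma hasDerivAt_mul_carrier_time {W : ℝ → ℂ} {W' : ℂ} {ρ α ν x t : ℝ}
    (h : HasDerivAt W (W' + Complex.I * ν * W t) t) :
    HasDerivAt (fun s => ρ * W s * carrier α ν x s) (ρ * W' * carrier α ν x t) t := by
  have h0 : HasDerivAt (fun s : ℝ => Complex.I * (α * (x : ℂ) - ν * s))
      (Complex.I * (-(ν * 1))) t :=
    (((hasDerivAt_id t).ofReal_comp.const_mul (ν : ℂ)).const_sub _).const_mul _
  refine ((h.const_mul (ρ : ℂ)).mul h0.cexp).congr_deriv ?_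
  simp only [carrier]
  ring

lemma conj_carrier_mul (α ν x t : ℝ) : conj (carrier α ν x t) * carrier α ν x t = 1 := by
  rw [carrier, ← Complex.exp_conj, ← Complex.exp_add]
  simp

/-! ### The tau functions -/

variable {N : ℕ}

/-- The diagonal entries `d_i exp(-ξ_i - η_i)` of the matrix in the tau functions. -/
def excitation (ε₁ ε₂ ρ₁ ρ₂ : ℝ) (p q : Fin N → ℂ) (d ξ₀ : Fin N → ℝ) (x t : ℝ) : Fin N → ℂ :=
  fun i => d i * Complex.exp (-phase ε₁ ε₂ ρ₁ ρ₂ (p i) (ξ₀ i) x t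
    - phase ε₁ ε₂ ρ₁ ρ₂ (q i) (ξ₀ i) x t)

lemma hasDerivAt_excitation_space (ε₁ ε₂ ρ₁ ρ₂ : ℝ) (p q : Fin N → ℂ) (d ξ₀ : Fin N → ℝ)
    (x t : ℝ) :
    HasDerivAt (fun y => excitation ε₁ ε₂ ρ₁ ρ₂ p q d ξ₀ y t)
      (-((p + q) * excitation ε₁ ε₂ ρ₁ ρ₂ p q d ξ₀ x t)) x := by
  refine hasDerivAt_pi.2 fun i => ?_
  have h0 : ∀ r : ℂ, HasDerivAt (fun y => phase ε₁ ε₂ ρ₁ ρ₂ r (ξ₀ i) y t) (r * 1) x := fun r =>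
    ((((hasDerivAt_id x).ofReal_comp.sub_const _).const_mul r).add_const _).add_const _
  refine (((h0 (p i)).neg.sub (h0 (q i))).cexp.const_mul (d i : ℂ)).congr_deriv ?_
  simp only [excitation, Pi.sub_apply, Pi.neg_apply, Pi.mul_apply, Pi.add_apply]
  ring

lemma hasDerivAt_excitation_time (ε₁ ε₂ ρ₁ ρ₂ : ℝ) (p q : Fin N → ℂ) (d ξ₀ : Fin N → ℝ)
    (x t : ℝ) :
    HasDerivAt (fun s => excitation ε₁ ε₂ ρ₁ ρ₂ p q d ξ₀ x s)
      (-((p ^ 3 + q ^ 3) * excitation ε₁ ε₂ ρ₁ ρ₂ p q d ξ₀ x t)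
        + (3 * (ε₁ * ρ₁ ^ 2 + ε₂ * ρ₂ ^ 2 : ℂ)) •
          ((p + q) * excitation ε₁ ε₂ ρ₁ ρ₂ p q d ξ₀ x t)) t := by
  refine hasDerivAt_pi.2 fun i => ?_
  have h0 : ∀ r : ℂ, HasDerivAt (fun s => phase ε₁ ε₂ ρ₁ ρ₂ r (ξ₀ i) x s)
      (r * (-(3 * (ε₁ * ρ₁ ^ 2 + ε₂ * ρ₂ ^ 2 : ℂ) * 1)) + r ^ 3 * 1) t := fun r =>
    (((((hasDerivAt_id t).ofReal_comp.const_mul _).const_sub _).const_mul r).add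
      ((hasDerivAt_id t).ofReal_comp.const_mul _)).add_const _
  refine (((h0 (p i)).neg.sub (h0 (q i))).cexp.const_mul (d i : ℂ)).congr_deriv ?_
  simp only [excitation, Pi.sub_apply, Pi.neg_apply, Pi.mul_apply, Pi.add_apply,
    Pi.smul_apply, Pi.pow_apply, smul_eq_mul]
  ring

lemma contDiff_tau (ε₁ ε₂ ρ₁ ρ₂ α₁ α₂ : ℝ) (p q : Fin N → ℂ) (d ξ₀ : Fin N → ℝ) (k l : ℤ) :
    ContDiff ℝ ∞ fun z : ℝ × ℝ => tau ε₁ ε₂ ρ₁ ρ₂ α₁ α₂ p q d ξ₀ k l z.1 z.2 := by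
  have hc : ContDiff ℝ ∞ (fun x : ℝ => (x : ℂ)) := Complex.ofRealCLM.contDiff
  have hph : ∀ r s, ContDiff ℝ ∞ fun z : ℝ × ℝ => phase ε₁ ε₂ ρ₁ ρ₂ r s z.1 z.2 := by
    intro r s
    have h₁ := hc.comp (contDiff_fst (𝕜 := ℝ) (E := ℝ) (F := ℝ) (n := ∞))
    have h₂ := hc.comp (contDiff_snd (𝕜 := ℝ) (E := ℝ) (F := ℝ) (n := ∞))
    exact ((contDiff_const.mul (h₁.sub (contDiff_const.mul h₂))).add
      (contDiff_const.mul h₂)).add contDiff_const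
  simp only [tau, det_apply]
  refine ContDiff.sum fun σ _ => ContDiff.const_smul _ (contDiff_prod fun i _ => ?_)
  simp only [Matrix.of_apply]
  refine ContDiff.add ?_ contDiff_const
  split_ifs
  · exact contDiff_const.mul ((hph _ _).neg.sub (hph _ _)).cexp
  · exact contDiff_const

lemma contDiffOn_soliton_tau (ε₁ ε₂ ρ₁ ρ₂ α₁ α₂ ρ α w : ℝ) (p q : Fin N → ℂ)
    (d ξ₀ : Fin N → ℝ) (k l : ℤ) :
    ContDiffOn ℝ ∞ (fun z : ℝ × ℝ =>
      soliton ρ α w (tau ε₁ ε₂ ρ₁ ρ₂ α₁ α₂ p q d ξ₀ k l)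
        (tau ε₁ ε₂ ρ₁ ρ₂ α₁ α₂ p q d ξ₀ 0 0) z.1 z.2)
      {z : ℝ × ℝ | tau ε₁ ε₂ ρ₁ ρ₂ α₁ α₂ p q d ξ₀ 0 0 z.1 z.2 ≠ 0} := by
  have hc : ContDiff ℝ ∞ (fun x : ℝ => (x : ℂ)) := Complex.ofRealCLM.contDiff
  have h₁ := hc.comp (contDiff_fst (𝕜 := ℝ) (E := ℝ) (F := ℝ) (n := ∞))
  have h₂ := hc.comp (contDiff_snd (𝕜 := ℝ) (E := ℝ) (F := ℝ) (n := ∞))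
  have hE : ContDiff ℝ ∞ fun z : ℝ × ℝ => Complex.exp (Complex.I * (α * z.1 - w * z.2)) :=
    (contDiff_const.mul ((contDiff_const.mul h₁).sub (contDiff_const.mul h₂))).cexp
  simp only [soliton, div_eq_mul_inv]
  exact (contDiffOn_const.mul
    ((contDiff_tau ε₁ ε₂ ρ₁ ρ₂ α₁ α₂ p q d ξ₀ k l).contDiffOn.mul
      ((contDiff_tau ε₁ ε₂ ρ₁ ρ₂ α₁ α₂ p q d ξ₀ 0 0).contDiffOn.inv fun z hz => hz))).mul
    hE.contDiffOn

lemma tau_zero_zero (ε₁ ε₂ ρ₁ ρ₂ α₁ α₂ : ℝ) (p q : Fin N → ℂ) (d ξ₀ : Fin N → ℝ) (x t : ℝ) :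
    tau ε₁ ε₂ ρ₁ ρ₂ α₁ α₂ p q d ξ₀ 0 0 x t
      = (gram p q (excitation ε₁ ε₂ ρ₁ ρ₂ p q d ξ₀ x t)).det := by
  rw [tau]
  congr 1
  ext i j
  rcases eq_or_ne i j with rfl | h
  · simp [gram, excitation]
  · simp [gram, h]

/-- The shift `k ↦ k + 1` changes the Gram-type matrix by a matrix of rank one, because
`-(p - z) / ((p + q) (q + z)) = 1 / (p + q) - 1 / (q + z)`. -/
lemma det_shift {p q e : Fin N → ℂ} {z : ℂ} (hpq : ∀ i j, p i + q j ≠ 0)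
    (hq : ∀ i, q i + z ≠ 0) (hdet : (gram p q e).det ≠ 0) :
    det (Matrix.of fun i j => (if i = j then e i else 0)
      + 1 / (p i + q j) * (-((p i - z) / (q j + z)))) = (gram p q e).det * wave p q e z := by
  rw [wave, ← det_gram_sub_vecMulVec p q e 1 (pole q z) hdet]
  congr 1
  ext i j
  have h₁ := hpq i j
  have h₂ := hq j
  have h₃ : 1 / (p i + q j) * (-((p i - z) / (q j + z))) = 1 / (p i + q j) - 1 / (q j + z) := by
    field_simp
    ring
  simp only [Matrix.of_apply, h₃, gram, pole, Matrix.sub_apply, Matrix.add_apply, diagonal_apply,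
    vecMulVec_apply, Pi.one_apply]
  ring

/-- The shift `k ↦ k - 1` changes the Gram-type matrix by a matrix of rank one, because
`-(q + z) / ((p + q) (p - z)) = 1 / (p + q) - 1 / (p - z)`. -/
lemma det_shift_inv {p q e : Fin N → ℂ} {z : ℂ} (hpq : ∀ i j, p i + q j ≠ 0)
    (hp : ∀ i, p i - z ≠ 0) (hdet : (gram p q e).det ≠ 0) :
    det (Matrix.of fun i j => (if i = j then e i else 0)
      + 1 / (p i + q j) * (-((p i - z) / (q j + z)))⁻¹) = (gram p q e).det * coWave p q e z := by
  rw [coWave, ← det_gram_sub_vecMulVec p q e (pole p (-z)) 1 hdet]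
  congr 1
  ext i j
  have h₁ := hpq i j
  have h₂ := hp i
  have h₃ : 1 / (p i + q j) * (-((p i - z) / (q j + z)))⁻¹ = 1 / (p i + q j) - 1 / (p i - z) := by
    rw [← neg_inv, inv_div]
    field_simp
    ring
  simp only [Matrix.of_apply, h₃, gram, pole, Matrix.sub_apply, Matrix.add_apply, diagonal_apply,
    vecMulVec_apply, Pi.one_apply, ← sub_eq_add_neg]
  ring

/-- The conjugacy relations say that conjugation exchanges `p` and `q` up to one permutation `σ`:
the identity on the first and last `h` indices, and the reversal on the others. -/
lemma exists_conj_perm {h : ℕ} {p q : Fin N → ℂ} {d ξ₀ : Fin N → ℝ}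
    (hconj : ConjRel h p q d ξ₀) :
    ∃ σ : Equiv.Perm (Fin N), ∀ i, conj (p i) = q (σ i) ∧ conj (q i) = p (σ i) ∧
      d (σ i) = d i ∧ ξ₀ (σ i) = ξ₀ i := by
  have hinv : Function.Involutive fun i : Fin N =>
      if (i : ℕ) < h ∨ (i.rev : ℕ) < h then i else i.rev := by
    intro i
    by_cases hi : (i : ℕ) < h ∨ (i.rev : ℕ) < h
    · simp only [if_pos hi]
    · have hi' : ¬ ((i.rev : ℕ) < h ∨ (i : ℕ) < h) := by tauto
      simp only [if_neg hi, Fin.rev_rev, if_neg hi']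
  refine ⟨hinv.toPerm, fun i => ?_⟩
  have hcc : ∀ {a b : ℂ}, a = conj b → conj a = b := fun h => by rw [h, Complex.conj_conj]
  simp only [Function.Involutive.coe_toPerm]
  by_cases h₁ : (i : ℕ) < h
  · obtain ⟨h₂, -⟩ := hconj.self i (by omega)
    simp [h₁, h₂]
  by_cases h₂ : (i.rev : ℕ) < h
  · obtain ⟨-, h₃⟩ := hconj.self i.rev (by omega)
    rw [Fin.rev_rev] at h₃
    simp [h₂, h₃, -Fin.val_rev]
  rw [if_neg (by tauto)]
  by_cases h₃ : (i : ℕ) + 1 ≤ (N + 1) / 2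
  · obtain ⟨h₄, h₅, h₆, h₇⟩ := hconj.paired i (by omega) h₃
    exact ⟨hcc h₄, h₅.symm, h₆.symm, h₇.symm⟩
  · have h₈ : (i.rev : ℕ) + 1 ≤ (N + 1) / 2 := by
      rw [Fin.val_rev]
      omega
    obtain ⟨h₄, h₅, h₆, h₇⟩ := hconj.paired i.rev (by omega) h₈
    rw [Fin.rev_rev] at h₄ h₅ h₆ h₇
    exact ⟨hcc h₅, h₄.symm, h₆, h₇⟩

/-- Conjugation transposes the matrix of `τ_{k,l}`, permutes its rows and columns by `σ`, and
inverts the factors raised to the powers `k` and `l`. -/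
lemma conj_tau {ε₁ ε₂ ρ₁ ρ₂ α₁ α₂ : ℝ} {p q : Fin N → ℂ} {d ξ₀ : Fin N → ℝ}
    {σ : Equiv.Perm (Fin N)} (hσ : ∀ i, conj (p i) = q (σ i) ∧ conj (q i) = p (σ i) ∧
      d (σ i) = d i ∧ ξ₀ (σ i) = ξ₀ i) (k l : ℤ) (x t : ℝ) :
    conj (tau ε₁ ε₂ ρ₁ ρ₂ α₁ α₂ p q d ξ₀ k l x t)
      = tau ε₁ ε₂ ρ₁ ρ₂ α₁ α₂ p q d ξ₀ (-k) (-l) x t := by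
  rw [tau, tau, RingHom.map_det, ← det_transpose, ← det_submatrix_equiv_self σ (Matrix.of _)]
  congr 1
  ext i j
  obtain ⟨hpi, hqi, hdi, hξi⟩ := hσ i
  obtain ⟨hpj, hqj, hdj, hξj⟩ := hσ j
  have hph : ∀ r s, conj (phase ε₁ ε₂ ρ₁ ρ₂ r s x t) = phase ε₁ ε₂ ρ₁ ρ₂ (conj r) s x t := by
    intro r s
    simp [phase, map_ofNat]
  have hfac : ∀ α : ℝ, conj (-((p j - Complex.I * α) / (q i + Complex.I * α)))
      = (-((p (σ i) - Complex.I * α) / (q (σ j) + Complex.I * α)))⁻¹ := by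
    intro α
    rw [← neg_inv, inv_div]
    simp only [map_neg, map_div₀, map_sub, map_add, map_mul, Complex.conj_I, Complex.conj_ofReal,
      hpj, hqi]
    ring
  simp only [transpose_apply, RingHom.mapMatrix_apply, Matrix.map_apply, Matrix.of_apply,
    submatrix_apply, map_add, map_mul, map_zpow₀, hfac, _root_.inv_zpow', map_div₀, map_one,
    hpj, hqi, σ.injective.eq_iff]
  rw [add_comm (q (σ j))]
  congr 3
  by_cases hij : i = j
  · subst hij
    simp only [if_true, map_mul, Complex.conj_ofReal, ← Complex.exp_conj, map_sub, map_neg, hph,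
      hpi, hqi, hdi, hξi]
    congr 2
    ring
  · simp [hij, Ne.symm hij]

/-- The equations `G(p_i, q_i) = 0`, multiplied by `p_i + q_i` and split into partial fractions. -/
lemma smul_pole_add_eq {ε₁ ε₂ ρ₁ ρ₂ α₁ α₂ : ℝ} {p q : Fin N → ℂ}
    (hp : ∀ i, p i - Complex.I * α₁ ≠ 0 ∧ p i - Complex.I * α₂ ≠ 0)
    (hq : ∀ i, q i + Complex.I * α₁ ≠ 0 ∧ q i + Complex.I * α₂ ≠ 0)
    (hG : ∀ i, G ε₁ ε₂ ρ₁ ρ₂ α₁ α₂ (p i) (q i) = 0) :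
    (ε₁ * ρ₁ ^ 2 : ℂ) • (pole p (-(Complex.I * α₁)) + pole q (Complex.I * α₁))
      + (ε₂ * ρ₂ ^ 2 : ℂ) • (pole p (-(Complex.I * α₂)) + pole q (Complex.I * α₂)) = p + q := by
  funext i
  have h := hG i
  have hs : ∀ α : ℝ, p i - Complex.I * α ≠ 0 → q i + Complex.I * α ≠ 0 →
      1 / (p i - Complex.I * α) + 1 / (q i + Complex.I * α)
        = (p i + q i) * (1 / ((p i - Complex.I * α) * (q i + Complex.I * α))) := by
    intro α h₁ h₂
    field_simp
    ring
  simp only [Pi.add_apply, Pi.smul_apply, pole, smul_eq_mul, ← sub_eq_add_neg,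
    hs _ (hp i).1 (hq i).1, hs _ (hp i).2 (hq i).2]
  rw [G] at h
  linear_combination (p i + q i) * h

/-! ### The coupled Hirota system -/

/-- The derivatives of one component that enter the equation, where `f ≠ 0`.  The frequency `omega`
turns the constant terms of the time derivative into `∑ ε_k ρ_k² i α_k`. -/
lemma soliton_derivs {ε₁ ε₂ ρ₁ ρ₂ α₁ α₂ ρ α : ℝ} {p q : Fin N → ℂ} {d ξ₀ : Fin N → ℝ}
    {f g : ℝ → ℝ → ℂ} {x t : ℝ} (hpq : ∀ i j, p i + q j ≠ 0)
    (hq : ∀ i, q i + Complex.I * α ≠ 0)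
    (hf : f = tau ε₁ ε₂ ρ₁ ρ₂ α₁ α₂ p q d ξ₀ 0 0)
    (hg : ∀ x t, f x t ≠ 0 →
      g x t / f x t = wave p q (excitation ε₁ ε₂ ρ₁ ρ₂ p q d ξ₀ x t) (Complex.I * α))
    (hx : f x t ≠ 0) {w : ℝ} (hw : w = omega ε₁ ε₂ ρ₁ ρ₂ α₁ α₂ α) {e : Fin N → ℂ}
    (he : e = excitation ε₁ ε₂ ρ₁ ρ₂ p q d ξ₀ x t) :
    soliton ρ α w g f x t = ρ * wave p q e (Complex.I * α) * carrier α w x t ∧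
    deriv (fun y => soliton ρ α w g f y t) x
      = ρ * wave₁ p q e (Complex.I * α) * carrier α w x t ∧
    iteratedDeriv 3 (fun y => soliton ρ α w g f y t) x
      = ρ * wave₃ p q e (Complex.I * α) * carrier α w x t ∧
    deriv (fun s => soliton ρ α w g f x s) t
      = ρ * (wave₃ p q e (Complex.I * α)
        - 3 * ((ε₁ * ρ₁ ^ 2 + ε₂ * ρ₂ ^ 2) - massDeriv p q e) * wave₁ p q e (Complex.I * α)
        - 3 * wave p q e (Complex.I * α) * (ε₁ * ρ₁ ^ 2 * (Complex.I * α₁)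
          + ε₂ * ρ₂ ^ 2 * (Complex.I * α₂)
          + moment p q e 1 1 * massDeriv p q e - fluxDeriv p q e)) * carrier α w x t := by
  subst he
  have hdet : ∀ {x t}, f x t ≠ 0 → (gram p q (excitation ε₁ ε₂ ρ₁ ρ₂ p q d ξ₀ x t)).det ≠ 0 := by
    intro x t h
    rwa [hf, tau_zero_zero] at h
  have hcont : Continuous fun z : ℝ × ℝ => f z.1 z.2 := by
    rw [hf]
    exact (contDiff_tau ε₁ ε₂ ρ₁ ρ₂ α₁ α₂ p q d ξ₀ 0 0).continuous
  have hU : IsOpen {y : ℝ | f y t ≠ 0} :=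
    isOpen_ne_fun (hcont.comp (by fun_prop : Continuous fun y : ℝ => (y, t))) continuous_const
  have hV : IsOpen {s : ℝ | f x s ≠ 0} :=
    isOpen_ne_fun (hcont.comp (by fun_prop : Continuous fun s : ℝ => (x, s))) continuous_const
  have hsol : ∀ {x t}, f x t ≠ 0 → soliton ρ α w g f x t
      = ρ * wave p q (excitation ε₁ ε₂ ρ₁ ρ₂ p q d ξ₀ x t) (Complex.I * α) * carrier α w x t := by
    intro x t h
    rw [soliton, hg x t h, carrier]
  have hsp := fun y => hasDerivAt_excitation_space ε₁ ε₂ ρ₁ ρ₂ p q d ξ₀ y t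
  have h₁ : ∀ y ∈ {y : ℝ | f y t ≠ 0}, HasDerivAt (fun y => soliton ρ α w g f y t)
      (ρ * wave₁ p q (excitation ε₁ ε₂ ρ₁ ρ₂ p q d ξ₀ y t) (Complex.I * α) * carrier α w y t) y :=
    fun y hy => (hasDerivAt_mul_carrier_space
      (hasDerivAt_wave hpq hq (hsp y) (hdet hy))).congr_of_eventuallyEq
      (Filter.eventuallyEq_of_mem (hU.mem_nhds hy) fun y' hy' => hsol hy')
  refine ⟨hsol hx, (h₁ x hx).deriv, ?_, ?_⟩
  · exact iteratedDeriv_three_eq hU h₁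
      (fun y hy => hasDerivAt_mul_carrier_space (hasDerivAt_wave₁ hpq hq (hsp y) (hdet hy)))
      (fun y hy => hasDerivAt_mul_carrier_space (hasDerivAt_wave₂ hpq hq (hsp y) (hdet hy))) hx
  · refine HasDerivAt.deriv (HasDerivAt.congr_of_eventuallyEq (hasDerivAt_mul_carrier_time
      ((hasDerivAt_wave_time hpq hq (hasDerivAt_excitation_time ε₁ ε₂ ρ₁ ρ₂ p q d ξ₀ x t)
        (hdet hx)).congr_deriv ?_))
      (Filter.eventuallyEq_of_mem (hV.mem_nhds hx) fun s hs => hsol hs))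
    have h3 : (Complex.I * α) ^ 3 = -(Complex.I * α ^ 3) := by
      rw [mul_pow, Complex.I_pow_three]
      ring
    rw [h3, hw, omega]
    push_cast
    ring

lemma conj_mul_modulated {ρ α ν x t : ℝ} {W V X : ℂ} (h : conj W = V) :
    conj (ρ * W * carrier α ν x t) * (ρ * X * carrier α ν x t) = ρ ^ 2 * (V * X) := by
  simp only [map_mul, Complex.conj_ofReal, h]
  linear_combination (ρ : ℂ) ^ 2 * V * X * conj_carrier_mul α ν x t

lemma isSolutionOn_soliton {h : ℕ} {ε₁ ε₂ ρ₁ ρ₂ α₁ α₂ : ℝ} {p q : Fin N → ℂ} {d ξ₀ : Fin N → ℝ}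
    (hpq : ∀ i j, p i + q j ≠ 0)
    (hp : ∀ i, p i - Complex.I * α₁ ≠ 0 ∧ p i - Complex.I * α₂ ≠ 0)
    (hq : ∀ i, q i + Complex.I * α₁ ≠ 0 ∧ q i + Complex.I * α₂ ≠ 0)
    (hconj : ConjRel h p q d ξ₀) (hG : ∀ i, G ε₁ ε₂ ρ₁ ρ₂ α₁ α₂ (p i) (q i) = 0)
    {f g₁ g₂ u₁ u₂ : ℝ → ℝ → ℂ}
    (hf : f = tau ε₁ ε₂ ρ₁ ρ₂ α₁ α₂ p q d ξ₀ 0 0)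
    (hg₁ : g₁ = tau ε₁ ε₂ ρ₁ ρ₂ α₁ α₂ p q d ξ₀ 1 0)
    (hg₂ : g₂ = tau ε₁ ε₂ ρ₁ ρ₂ α₁ α₂ p q d ξ₀ 0 1)
    (hu₁ : u₁ = soliton ρ₁ α₁ (omega ε₁ ε₂ ρ₁ ρ₂ α₁ α₂ α₁) g₁ f)
    (hu₂ : u₂ = soliton ρ₂ α₂ (omega ε₁ ε₂ ρ₁ ρ₂ α₁ α₂ α₂) g₂ f) :
    IsSolutionOn ε₁ ε₂ u₁ u₂ {z : ℝ × ℝ | f z.1 z.2 ≠ 0} := by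
  have hdet : ∀ {x t}, f x t ≠ 0 →
      (gram p q (excitation ε₁ ε₂ ρ₁ ρ₂ p q d ξ₀ x t)).det ≠ 0 := by
    intro x t hx
    rwa [hf, tau_zero_zero] at hx
  have hfe : ∀ x t, f x t = (gram p q (excitation ε₁ ε₂ ρ₁ ρ₂ p q d ξ₀ x t)).det := by
    intro x t
    rw [hf, tau_zero_zero]
  have hw₁ : ∀ x t, f x t ≠ 0 → g₁ x t / f x t
      = wave p q (excitation ε₁ ε₂ ρ₁ ρ₂ p q d ξ₀ x t) (Complex.I * α₁) := by
    intro x t hx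
    rw [div_eq_iff hx, mul_comm, hfe, ← det_shift hpq (fun i => (hq i).1) (hdet hx), hg₁, tau]
    simp +contextual [excitation]
  have hw₂ : ∀ x t, f x t ≠ 0 → g₂ x t / f x t
      = wave p q (excitation ε₁ ε₂ ρ₁ ρ₂ p q d ξ₀ x t) (Complex.I * α₂) := by
    intro x t hx
    rw [div_eq_iff hx, mul_comm, hfe, ← det_shift hpq (fun i => (hq i).2) (hdet hx), hg₂, tau]
    simp +contextual [excitation]
  obtain ⟨σ, hσ⟩ := exists_conj_perm hconj
  -- Since `f` is real, the conjugate of `g / f` is the ratio with the opposite shift.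
  have hfc : ∀ x t, conj (f x t) = f x t := by
    intro x t
    rw [hf, conj_tau hσ]
    simp
  have hv₁ : ∀ x t, f x t ≠ 0 → conj (g₁ x t / f x t)
      = coWave p q (excitation ε₁ ε₂ ρ₁ ρ₂ p q d ξ₀ x t) (Complex.I * α₁) := by
    intro x t hx
    rw [map_div₀, hfc, div_eq_iff hx, mul_comm, hfe,
      ← det_shift_inv hpq (fun i => (hp i).1) (hdet hx), hg₁, conj_tau hσ, tau]
    simp +contextual [excitation]
  have hv₂ : ∀ x t, f x t ≠ 0 → conj (g₂ x t / f x t)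
      = coWave p q (excitation ε₁ ε₂ ρ₁ ρ₂ p q d ξ₀ x t) (Complex.I * α₂) := by
    intro x t hx
    rw [map_div₀, hfc, div_eq_iff hx, mul_comm, hfe,
      ← det_shift_inv hpq (fun i => (hp i).2) (hdet hx), hg₂, conj_tau hσ, tau]
    simp +contextual [excitation]
  have hR₁ : ∀ x t, f x t ≠ 0 →
      conj (wave p q (excitation ε₁ ε₂ ρ₁ ρ₂ p q d ξ₀ x t) (Complex.I * α₁))
        = coWave p q (excitation ε₁ ε₂ ρ₁ ρ₂ p q d ξ₀ x t) (Complex.I * α₁) :=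
    fun x t hx => by rw [← hw₁ x t hx, hv₁ x t hx]
  have hR₂ : ∀ x t, f x t ≠ 0 →
      conj (wave p q (excitation ε₁ ε₂ ρ₁ ρ₂ p q d ξ₀ x t) (Complex.I * α₂))
        = coWave p q (excitation ε₁ ε₂ ρ₁ ρ₂ p q d ξ₀ x t) (Complex.I * α₂) :=
    fun x t hx => by rw [← hw₂ x t hx, hv₂ x t hx]
  -- On the set `f ≠ 0` the two nonlinear terms are expressed by the moments.
  have hpair : ∀ {x t}, f x t ≠ 0 →
      (ε₁ * (‖u₁ x t‖ : ℂ) ^ 2 + ε₂ * (‖u₂ x t‖ : ℂ) ^ 2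
        = (ε₁ * ρ₁ ^ 2 + ε₂ * ρ₂ ^ 2)
          - massDeriv p q (excitation ε₁ ε₂ ρ₁ ρ₂ p q d ξ₀ x t)) ∧
      (ε₁ * conj (u₁ x t) * deriv (fun y => u₁ y t) x
        + ε₂ * conj (u₂ x t) * deriv (fun y => u₂ y t) x
        = ε₁ * ρ₁ ^ 2 * (Complex.I * α₁) + ε₂ * ρ₂ ^ 2 * (Complex.I * α₂)
          + moment p q (excitation ε₁ ε₂ ρ₁ ρ₂ p q d ξ₀ x t) 1 1
            * massDeriv p q (excitation ε₁ ε₂ ρ₁ ρ₂ p q d ξ₀ x t)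
          - fluxDeriv p q (excitation ε₁ ε₂ ρ₁ ρ₂ p q d ξ₀ x t)) := by
    intro x t hx
    obtain ⟨a₁, b₁, -, -⟩ := soliton_derivs (ρ := ρ₁) hpq (fun i => (hq i).1) hf hw₁ hx rfl rfl
    obtain ⟨a₂, b₂, -, -⟩ := soliton_derivs (ρ := ρ₂) hpq (fun i => (hq i).2) hf hw₂ hx rfl rfl
    have hc := smul_pole_add_eq hp hq hG
    have s₁ := sum_coWave_mul_wave hpq (fun i => (hp i).1) (fun i => (hp i).2)
      (fun i => (hq i).1) (fun i => (hq i).2) (hdet hx) hc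
    have s₂ := sum_coWave_mul_wave₁ hpq (fun i => (hp i).1) (fun i => (hp i).2)
      (fun i => (hq i).1) (fun i => (hq i).2) (hdet hx) hc
    rw [hu₁, hu₂, ← Complex.conj_mul', ← Complex.conj_mul', b₁, b₂, a₁, a₂, mul_assoc (ε₁ : ℂ),
      mul_assoc (ε₂ : ℂ), conj_mul_modulated (hR₁ x t hx), conj_mul_modulated (hR₂ x t hx),
      conj_mul_modulated (hR₁ x t hx), conj_mul_modulated (hR₂ x t hx)]
    exact ⟨by linear_combination -s₁, by linear_combination s₂⟩
  refine ⟨?_, ?_, ?_, fun x t hx => ?_, fun x t hx => ?_⟩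
  · refine isOpen_ne_fun ?_ continuous_const
    rw [hf]
    exact (contDiff_tau ε₁ ε₂ ρ₁ ρ₂ α₁ α₂ p q d ξ₀ 0 0).continuous
  · rw [hu₁, hg₁, hf]
    exact contDiffOn_soliton_tau _ _ _ _ _ _ _ _ _ _ _ _ _ _ _
  · rw [hu₂, hg₂, hf]
    exact contDiffOn_soliton_tau _ _ _ _ _ _ _ _ _ _ _ _ _ _ _
  · obtain ⟨a, b, c, e⟩ := soliton_derivs (ρ := ρ₁) hpq (fun i => (hq i).1) hf hw₁ hx rfl rfl
    rw [rhs, (hpair hx).1, (hpair hx).2, hu₁, a, b, c, e]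
    ring
  · obtain ⟨a, b, c, e⟩ := soliton_derivs (ρ := ρ₂) hpq (fun i => (hq i).2) hf hw₂ hx rfl rfl
    rw [rhs, (hpair hx).1, (hpair hx).2, hu₂, a, b, c, e]
    ring

end

end CoupledHirota

theorem theorem3p1 (N : ℕ) (hN : 1 ≤ N)
    (ε₁ ε₂ ρ₁ ρ₂ α₁ α₂ : ℝ) (p q : Fin N → ℂ) (d ξ₀ : Fin N → ℝ)
    (hpq : ∀ i j, p i + q j ≠ 0)
    (hp : ∀ i, p i - Complex.I * α₁ ≠ 0 ∧ p i - Complex.I * α₂ ≠ 0)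
    (hq : ∀ i, q i + Complex.I * α₁ ≠ 0 ∧ q i + Complex.I * α₂ ≠ 0)
    (h : ℕ) (hh : h ≤ N / 2)
    (hconj : CoupledHirota.ConjRel h p q d ξ₀)
    (hG : ∀ i, CoupledHirota.G ε₁ ε₂ ρ₁ ρ₂ α₁ α₂ (p i) (q i) = 0)
    (f g₁ g₂ u₁ u₂ : ℝ → ℝ → ℂ)
    (hf : f = CoupledHirota.tau ε₁ ε₂ ρ₁ ρ₂ α₁ α₂ p q d ξ₀ 0 0)
    (hg₁ : g₁ = CoupledHirota.tau ε₁ ε₂ ρ₁ ρ₂ α₁ α₂ p q d ξ₀ 1 0)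
    (hg₂ : g₂ = CoupledHirota.tau ε₁ ε₂ ρ₁ ρ₂ α₁ α₂ p q d ξ₀ 0 1)
    (hu₁ : u₁ = CoupledHirota.soliton ρ₁ α₁
      (CoupledHirota.omega ε₁ ε₂ ρ₁ ρ₂ α₁ α₂ α₁) g₁ f)
    (hu₂ : u₂ = CoupledHirota.soliton ρ₂ α₂
      (CoupledHirota.omega ε₁ ε₂ ρ₁ ρ₂ α₁ α₂ α₂) g₂ f) :
    CoupledHirota.IsSolutionOn ε₁ ε₂ u₁ u₂ {z : ℝ × ℝ | f z.1 z.2 ≠ 0} := by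
  exact CoupledHirota.isSolutionOn_soliton hpq hp hq hconj hG hf hg₁ hg₂ hu₁ hu₂
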